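/- For real numbers $p\in[0,1]$ and $\alpha\ge 0$, a finite simple graph $G$ is called $(p,\alpha)$-jumbled if $$\bigl|e(X,Y)-p|X||Y|\bigr|\le \alpha\sqrt{|X||Y|}\qquad\text{for all } X,Y\subseteq V(G),$$ where $e(X,Y)$ is the number of edges with one end in $X$ and the other in $Y$, edges with both ends in $X\cap Y$ being counted twice. For a graph $F$, an integer $n\ge 1$ and a real number $C>0$, let $\mathrm{ex}_{\mathrm{rand}}(n,C,F)$ be the maximum number of edges of an $n$-vertex graph that does not contain $F$ as a (not necessarily induced) subgraph and that is $(p,\alpha)$-jumbled for some $p\in[0,1]$ and some $\alpha\ge 0$ with $\alpha\le C\sqrt{np}$. Let $$\exp(F)=\lim_{C\to\infty}\ \limsup_{n\to\infty}\ \frac{\log\bigl(\mathrm{ex}_{\mathrm{rand}}(n,C,F)/n\bigr)}{\log n},$$ with the convention $\log 0=-\infty$ (the limit exists in the extended reals, since the limsup is non-decreasing in $C$). **Theorem.** For every integer $t\ge 4$, $$\exp(K_t)\ \ge\ 1-\frac{1}{t-1}.$$ -/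

import Mathlib

open Filter Topology
open scoped ENNReal

namespace PseudorandomTuran

/-- `e(X, Y)`: the number of edges with one end in `X` and the other in `Y`, an edge with both
ends in `X ∩ Y` being counted twice (that is, the number of ordered adjacent pairs in `X × Y`). -/
noncomputable def edgesBetween {V : Type*} (G : SimpleGraph V) (X Y : Finset V) : ℕ := by
  classical exact (G.interedges X Y).card

/-- `(p, α)`-jumbled graphs, `p ∈ [0, 1]` and `α ≥ 0`. -/
def IsJumbled {V : Type*} (G : SimpleGraph V) (p α : ℝ) : Prop :=
  0 ≤ p ∧ p ≤ 1 ∧ 0 ≤ α ∧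
    ∀ X Y : Finset V,
      |(edgesBetween G X Y : ℝ) - p * (X.card : ℝ) * (Y.card : ℝ)| ≤
        α * Real.sqrt ((X.card : ℝ) * (Y.card : ℝ))

/-- The possible numbers of edges of an `n`-vertex `F`-free graph that is `(p, α)`-jumbled for
some `p` and `α` with `α ≤ C √(n p)`. There is no further restriction on `p`. -/
def jumbledFreeSizes {W : Type*} (n : ℕ) (C : ℝ) (F : SimpleGraph W) : Set ℕ :=
  {m | ∃ G : SimpleGraph (Fin n), F.Free G ∧
      (∃ p α : ℝ, IsJumbled G p α ∧ α ≤ C * Real.sqrt ((n : ℝ) * p)) ∧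
      m = G.edgeSet.ncard}

/-- `ex_rand(n, C, F)`: the largest number of edges of an `n`-vertex `F`-free graph that is
`(p, α)`-jumbled for some `p` and `α` with `α ≤ C √(n p)`. -/
noncomputable def exRand {W : Type*} (n : ℕ) (C : ℝ) (F : SimpleGraph W) : ℕ :=
  sSup (jumbledFreeSizes n C F)

/-- `limsup_{n → ∞} log (ex_rand(n, C, F) / n) / log n`, with `log 0 = -∞`. -/
noncomputable def exponentAt {W : Type*} (F : SimpleGraph W) (C : ℝ) : EReal :=
  limsup (fun n : ℕ =>
    ENNReal.log ((exRand n C F : ℝ≥0∞) / (n : ℝ≥0∞)) / ((Real.log (n : ℝ) : ℝ) : EReal)) atTop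

/-- `exp(F) = lim_{C → ∞} limsup_{n → ∞} log (ex_rand(n, C, F) / n) / log n`.
The limit exists, see `tendsto_exponentAt`. -/
noncomputable def randExponent {W : Type*} (F : SimpleGraph W) : EReal :=
  limUnder atTop (fun C : ℝ => exponentAt F C)

theorem bddAbove_jumbledFreeSizes {W : Type*} (n : ℕ) (C : ℝ) (F : SimpleGraph W) :
    BddAbove (jumbledFreeSizes n C F) := by
  refine ⟨(Set.univ : Set (Sym2 (Fin n))).ncard, ?_⟩
  rintro m ⟨G, -, -, rfl⟩
  exact Set.ncard_le_ncard (Set.subset_univ _) (Set.toFinite _)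

/-- `exRand` is a maximum whenever there is a graph to consider. -/
theorem isGreatest_exRand {W : Type*} (n : ℕ) (C : ℝ) (F : SimpleGraph W)
    (h : (jumbledFreeSizes n C F).Nonempty) :
    IsGreatest (jumbledFreeSizes n C F) (exRand n C F) :=
  ⟨Nat.sSup_mem h (bddAbove_jumbledFreeSizes n C F),
    fun _ hm => le_csSup (bddAbove_jumbledFreeSizes n C F) hm⟩

theorem exRand_mono {W : Type*} (n : ℕ) (F : SimpleGraph W) :
    Monotone (fun C : ℝ => exRand n C F) := by
  intro C D hCD
  have hsub : jumbledFreeSizes n C F ⊆ jumbledFreeSizes n D F := by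
    rintro m ⟨G, hG, ⟨p, α, hj, hα⟩, rfl⟩
    exact ⟨G, hG, ⟨p, α, hj, hα.trans
      (mul_le_mul_of_nonneg_right hCD (Real.sqrt_nonneg _))⟩, rfl⟩
  rcases (jumbledFreeSizes n C F).eq_empty_or_nonempty with h | h
  · simp [exRand, h]
  · exact csSup_le_csSup (bddAbove_jumbledFreeSizes n D F) h hsub

theorem exponentAt_mono {W : Type*} (F : SimpleGraph W) : Monotone (exponentAt F) := by
  intro C D hCD
  refine limsup_le_limsup (Eventually.of_forall fun n => ?_)
  refine EReal.div_le_div_right_of_nonneg ?_ ?_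
  · exact_mod_cast Real.log_natCast_nonneg n
  · refine ENNReal.log_monotone (ENNReal.div_le_div_right ?_ _)
    exact_mod_cast exRand_mono n F hCD

/-- The limit that defines `exp(F)` exists. -/
theorem tendsto_exponentAt {W : Type*} (F : SimpleGraph W) :
    Tendsto (fun C : ℝ => exponentAt F C) atTop (𝓝 (randExponent F)) :=
  tendsto_nhds_limUnder ⟨_, tendsto_atTop_iSup (exponentAt_mono F)⟩

end PseudorandomTuran

/-!
Let `A` be a symmetric `t × t` matrix over `𝔽_q`, `q` odd, whose determinant is not a square, and
join two points of projective space when they are orthogonal for `A`. Restricted to the points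
whose norm `xᵀ A x` is a nonzero square, this graph is `K_t`-free: the Gram matrix `M A Mᵀ` of a
clique of size `t` would be diagonal with nonzero square entries, which forces `det A` to be a
square.

Distinct hyperplanes of `𝔽_q^t` meet in exactly `q^(t-2)` vectors, so their indicator functions are
pairwise uncorrelated. The resulting variance identity, in which each projective point is counted
`q - 1` times, and the Cauchy–Schwarz inequality show that the graph is
`(1/q, q^((t-2)/2))`-jumbled. When `A` splits off a hyperbolic plane there are `n ≥ q^(t-1) / 4`
points, whence `q^((t-2)/2) ≤ 2 √(n / q)`, and about `n² / q`, that is at least a constant multiple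
of `n^(2 - 1/(t-1))`, edges.
-/

namespace PseudorandomTuran

open Finset Matrix
open scoped LinearAlgebra.Projectivization

section Incidence

variable {ι F : Type*} [Fintype ι] [DecidableEq ι] [Field F] [Fintype F] [DecidableEq F]

theorem card_dotProduct_eq_zero_mul_pow {κ : Type*} [Fintype κ] {w : κ → ι → F}
    (hw : LinearIndependent F w) :
    #{z : ι → F | ∀ k, z ⬝ᵥ w k = 0} * Fintype.card F ^ Fintype.card κ =
      Fintype.card F ^ Fintype.card ι := by
  classical
  let f := (Matrix.of w).mulVecLin
  have hker : #{z : ι → F | ∀ k, z ⬝ᵥ w k = 0} = Fintype.card (LinearMap.ker f) := by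
    rw [← Fintype.card_subtype]
    refine Fintype.card_congr (Equiv.subtypeEquivRight fun z => ?_)
    simp only [f, LinearMap.mem_ker, mulVecLin_apply, funext_iff, mulVec, of_apply, Pi.zero_apply,
      dotProduct_comm z]
  have hrange : Module.finrank F (LinearMap.range f) = Fintype.card κ :=
    LinearIndependent.rank_matrix (M := Matrix.of w) hw
  have hrank := f.finrank_range_add_finrank_ker
  rw [hrange, Module.finrank_fintype_fun_eq_card] at hrank
  rw [hker, Module.card_eq_pow_finrank (K := F), ← pow_add, add_comm, hrank]

theorem card_hyperplane {w : ι → F} (hw : w ≠ 0) :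
    (#{z : ι → F | z ⬝ᵥ w = 0} : ℝ) =
      (Fintype.card F : ℝ) ^ Fintype.card ι / Fintype.card F := by
  have h := card_dotProduct_eq_zero_mul_pow
    (LinearIndependent.of_subsingleton (v := fun _ : Unit => w) () hw)
  simp only [forall_const, Fintype.card_unit, pow_one] at h
  rw [eq_div_iff (by positivity)]
  exact_mod_cast h

theorem card_inter_hyperplanes {w w' : ι → F} (hw : LinearIndependent F ![w, w']) :
    (#{z : ι → F | z ⬝ᵥ w = 0 ∧ z ⬝ᵥ w' = 0} : ℝ) =
      (Fintype.card F : ℝ) ^ Fintype.card ι / (Fintype.card F : ℝ) ^ 2 := by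
  have h := card_dotProduct_eq_zero_mul_pow hw
  simp only [Fin.forall_fin_two, cons_val_zero, cons_val_one, Fintype.card_fin] at h
  rw [eq_div_iff (by positivity)]
  exact_mod_cast h

/-- The indicator function of the hyperplane orthogonal to `w`, minus its mean `1 / |F|`. Centring
makes the functions of distinct hyperplanes uncorrelated. -/
noncomputable def centeredIndicator (w z : ι → F) : ℝ :=
  (if z ⬝ᵥ w = 0 then 1 else 0) - 1 / Fintype.card F

omit [DecidableEq ι] in
theorem centeredIndicator_units_smul (w z : ι → F) (u : Fˣ) :
    centeredIndicator w (u • z) = centeredIndicator w z := by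
  simp [centeredIndicator, Units.smul_def, smul_dotProduct]

theorem sum_centeredIndicator_mul {w w' : ι → F} (hw : w ≠ 0) (hw' : w' ≠ 0) :
    ∑ z, centeredIndicator w z * centeredIndicator w' z =
      #{z : ι → F | z ⬝ᵥ w = 0 ∧ z ⬝ᵥ w' = 0} -
        (Fintype.card F : ℝ) ^ Fintype.card ι / (Fintype.card F : ℝ) ^ 2 := by
  classical
  have hq : (Fintype.card F : ℝ) ≠ 0 := by positivity
  have hboth (z : ι → F) : (if z ⬝ᵥ w = 0 then (1 : ℝ) else 0) * (if z ⬝ᵥ w' = 0 then 1 else 0) =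
      if z ⬝ᵥ w = 0 ∧ z ⬝ᵥ w' = 0 then 1 else 0 := by
    rw [ite_and, ite_mul, one_mul, zero_mul]
  simp only [centeredIndicator, sub_mul, mul_sub, hboth, sum_sub_distrib, ← mul_sum, ← sum_mul,
    sum_boole, sum_const, card_univ, nsmul_eq_mul, card_hyperplane hw, card_hyperplane hw',
    Fintype.card_fun, Nat.cast_pow]
  field_simp
  ring

theorem sum_sq_sum_centeredIndicator {W : Type*} {w : W → ι → F} (hw : ∀ y, w y ≠ 0)
    (hind : Pairwise fun y y' => LinearIndependent F ![w y, w y']) (Y : Finset W) :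
    ∑ z, (∑ y ∈ Y, centeredIndicator (w y) z) ^ 2 =
      (Fintype.card F - 1) *
        (#Y * ((Fintype.card F : ℝ) ^ Fintype.card ι / (Fintype.card F : ℝ) ^ 2)) := by
  classical
  have hq : (Fintype.card F : ℝ) ≠ 0 := by positivity
  have huncorrelated (y y' : W) (h : y' ≠ y) :
      ∑ z, centeredIndicator (w y) z * centeredIndicator (w y') z = 0 := by
    rw [sum_centeredIndicator_mul (hw y) (hw y'), card_inter_hyperplanes (hind h.symm), sub_self]
  calc ∑ z, (∑ y ∈ Y, centeredIndicator (w y) z) ^ 2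
      = ∑ y ∈ Y, ∑ y' ∈ Y, ∑ z, centeredIndicator (w y) z * centeredIndicator (w y') z := by
        simp only [sq, sum_mul_sum]
        rw [sum_comm]
        exact sum_congr rfl fun y _ => sum_comm
    _ = ∑ y ∈ Y, ∑ z, centeredIndicator (w y) z * centeredIndicator (w y) z :=
        sum_congr rfl fun y hy => sum_eq_single_of_mem y hy fun y' _ => huncorrelated y y'
    _ = _ := by
        simp only [sum_centeredIndicator_mul (hw _) (hw _), and_self, card_hyperplane (hw _),
          sum_const, nsmul_eq_mul]
        field_simp

omit [DecidableEq F] in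
theorem mul_sum_rep_le_sum {E : Type*} [AddCommGroup E] [Module F E] [Fintype E] {f : E → ℝ}
    (hf : ∀ z, 0 ≤ f z) (hsmul : ∀ (u : Fˣ) z, f (u • z) = f z) (X : Finset (ℙ F E)) :
    ((Fintype.card F : ℝ) - 1) * ∑ x ∈ X, f x.rep ≤ ∑ z, f z := by
  classical
  have hinj : Function.Injective fun p : Fˣ × ℙ F E => p.1 • p.2.rep := by
    rintro ⟨u, x⟩ ⟨u', x'⟩ (h : u • x.rep = u' • x'.rep)
    obtain rfl : x = x' := by
      rw [← x.mk_rep, ← x'.mk_rep, Projectivization.mk_eq_mk_iff]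
      exact ⟨u⁻¹ * u', by rw [mul_smul, ← h, inv_smul_smul]⟩
    exact Prod.ext (Units.ext (smul_left_injective F x.rep_nonzero h)) rfl
  calc ((Fintype.card F : ℝ) - 1) * ∑ x ∈ X, f x.rep
      = ∑ p ∈ (univ : Finset Fˣ) ×ˢ X, f (p.1 • p.2.rep) := by
        simp only [hsmul, sum_product, sum_const, card_univ, nsmul_eq_mul, Fintype.card_units,
          Nat.cast_pred Fintype.card_pos]
    _ = ∑ z ∈ ((univ : Finset Fˣ) ×ˢ X).map ⟨_, hinj⟩, f z := by simp only [sum_map,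
        Function.Embedding.coeFn_mk]
    _ ≤ ∑ z, f z := sum_le_univ_sum_of_nonneg hf

theorem abs_card_orthogonal_sub_le {A : Matrix ι ι F} (hA : IsUnit A)
    (X Y : Finset (ℙ F (ι → F))) :
    |(#{p ∈ X ×ˢ Y | p.1.rep ⬝ᵥ A *ᵥ p.2.rep = 0} : ℝ) - 1 / Fintype.card F * #X * #Y| ≤
      √((Fintype.card F : ℝ) ^ Fintype.card ι / (Fintype.card F : ℝ) ^ 2) * √(#X * #Y) := by
  set V := (Fintype.card F : ℝ) ^ Fintype.card ι / (Fintype.card F : ℝ) ^ 2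
  let w (y : ℙ F (ι → F)) := A *ᵥ y.rep
  let D (z : ι → F) := ∑ y ∈ Y, centeredIndicator (w y) z
  have hAinj : Function.Injective A.mulVecLin := mulVec_injective_iff_isUnit.2 hA
  have hw (y) : w y ≠ 0 := (map_ne_zero_iff _ hAinj).2 y.rep_nonzero
  have hind : Pairwise fun y y' => LinearIndependent F ![w y, w y'] := fun y y' h => by
    have := (Projectivization.linearIndependent_pair_iff_ne.2 h).map' A.mulVecLin
      (LinearMap.ker_eq_bot.2 hAinj)
    rwa [← FinVec.map_eq] at this
  have hvar : ∑ x ∈ X, D x.rep ^ 2 ≤ #Y * V := by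
    have hq : (0 : ℝ) < Fintype.card F - 1 :=
      sub_pos.2 (by exact_mod_cast Fintype.one_lt_card (α := F))
    refine le_of_mul_le_mul_left ((mul_sum_rep_le_sum (f := fun z => D z ^ 2)
      (fun _ => sq_nonneg _) (fun u z => ?_) X).trans_eq
      (sum_sq_sum_centeredIndicator hw hind Y)) hq
    simp only [D, centeredIndicator_units_smul]
  have hD : (#{p ∈ X ×ˢ Y | p.1.rep ⬝ᵥ A *ᵥ p.2.rep = 0} : ℝ) - 1 / Fintype.card F * #X * #Y =
      ∑ x ∈ X, D x.rep := by
    simp only [D, w, centeredIndicator, sum_sub_distrib, sum_const, nsmul_eq_mul, card_filter,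
      sum_product, Nat.cast_sum, Nat.cast_ite, Nat.cast_one, Nat.cast_zero]
    ring
  rw [hD, ← Real.sqrt_mul (by positivity)]
  refine Real.abs_le_sqrt (sq_sum_le_card_mul_sum_sq.trans ?_)
  calc (#X : ℝ) * ∑ x ∈ X, D x.rep ^ 2 ≤ #X * (#Y * V) := by gcongr
    _ = V * (#X * #Y) := by ring

end Incidence

section SquareNormGraph

variable {ι F : Type*} [Fintype ι] [Field F]

/-- The points of projective space at which the quadratic form `x ↦ xᵀ A x` takes a nonzero square
value. Scaling a vector multiplies its value by a square, so the choice of representatives is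
immaterial. -/
def squareNormPoints (A : Matrix ι ι F) : Set (ℙ F (ι → F)) :=
  {x | x.rep ⬝ᵥ A *ᵥ x.rep ≠ 0 ∧ IsSquare (x.rep ⬝ᵥ A *ᵥ x.rep)}

theorem mk_mem_squareNormPoints {A : Matrix ι ι F} {v : ι → F} (hv : v ≠ 0)
    (h0 : v ⬝ᵥ A *ᵥ v ≠ 0) (hsq : IsSquare (v ⬝ᵥ A *ᵥ v)) :
    Projectivization.mk F v hv ∈ squareNormPoints A := by
  obtain ⟨u, hu⟩ := Projectivization.exists_smul_eq_mk_rep F v hv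
  have hnorm : (u • v) ⬝ᵥ A *ᵥ (u • v) = u * u * (v ⬝ᵥ A *ᵥ v) := by
    simp only [Units.smul_def, mulVec_smul, smul_dotProduct, dotProduct_smul, smul_eq_mul,
      mul_assoc]
  rw [squareNormPoints, Set.mem_ofPred_eq, ← hu, hnorm]
  exact ⟨mul_ne_zero (mul_ne_zero u.ne_zero u.ne_zero) h0, (IsSquare.mul_self _).mul hsq⟩

/-- The orthogonality graph of the symmetric form `A` on its points of nonzero square norm. -/
def squareNormGraph {A : Matrix ι ι F} (hA : A.IsSymm) : SimpleGraph (squareNormPoints A) where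
  Adj x y := x.1.rep ⬝ᵥ A *ᵥ y.1.rep = 0
  symm := ⟨fun x y h => by
    rwa [dotProduct_mulVec, dotProduct_comm, ← mulVec_transpose, hA.eq] at h⟩
  loopless := ⟨fun x => x.2.1⟩

theorem squareNormGraph_cliqueFree [DecidableEq ι] {A : Matrix ι ι F} (hA : A.IsSymm)
    (hdet : ¬ IsSquare A.det) : (squareNormGraph hA).CliqueFree (Fintype.card ι) := by
  rw [SimpleGraph.cliqueFree_iff_top_free]
  rintro ⟨f⟩
  let M : Matrix ι ι F := Matrix.of fun i => (f i).1.rep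
  have hgram : M * A * Mᵀ = diagonal fun i => (f i).1.rep ⬝ᵥ A *ᵥ (f i).1.rep := by
    ext i j
    have hentry : (M * A * Mᵀ) i j = (f i).1.rep ⬝ᵥ A *ᵥ (f j).1.rep := by
      rw [Matrix.mul_assoc, mul_apply_eq_vecMul]
      rfl
    rw [hentry, diagonal_apply]
    split_ifs with hij
    · rw [hij]
    · exact f.toHom.map_adj hij
  have hMdet : M.det * M.det * A.det = ∏ i, (f i).1.rep ⬝ᵥ A *ᵥ (f i).1.rep := by
    rw [← det_diagonal, ← hgram, det_mul, det_mul, det_transpose]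
    ring
  have hM : M.det ≠ 0 := fun h => prod_ne_zero_iff.2 (fun i _ => (f i).2.1) <| by
    rw [← hMdet, h, zero_mul, zero_mul]
  refine hdet ?_
  rw [eq_div_of_mul_eq (mul_ne_zero hM hM) ((mul_comm _ _).trans hMdet)]
  exact (isSquare_prod _ fun i _ => (f i).2.2).div (IsSquare.mul_self _)

theorem isJumbled_squareNormGraph [DecidableEq ι] [Fintype F] {A : Matrix ι ι F}
    (hA : A.IsSymm) (hunit : IsUnit A) :
    IsJumbled (squareNormGraph hA) (1 / Fintype.card F)
      √((Fintype.card F : ℝ) ^ Fintype.card ι / (Fintype.card F : ℝ) ^ 2) := by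
  classical
  refine ⟨by positivity, div_le_one_of_le₀ (by exact_mod_cast Fintype.card_pos) (by positivity),
    Real.sqrt_nonneg _, fun X Y => ?_⟩
  let e := Function.Embedding.subtype (· ∈ squareNormPoints A)
  have hcount : edgesBetween (squareNormGraph hA) X Y =
      #{p ∈ X.map e ×ˢ Y.map e | p.1.rep ⬝ᵥ A *ᵥ p.2.rep = 0} := by
    simp only [edgesBetween, SimpleGraph.interedges, Rel.interedges, card_filter, sum_product,
      sum_map]
    exact sum_congr rfl fun x _ => sum_congr rfl fun y _ => if_congr Iff.rfl rfl rfl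
  simpa only [hcount, card_map] using abs_card_orthogonal_sub_le hunit (X.map e) (Y.map e)

end SquareNormGraph

section HyperbolicSum

variable {κ F : Type*} [Fintype κ] [Field F]

/-- The Gram matrix of the orthogonal sum of a hyperbolic plane and the form `B`. The hyperbolic
plane makes it possible to write down the vectors of a given norm. -/
def hyperbolicSum (B : Matrix κ κ F) : Matrix (Fin 2 ⊕ κ) (Fin 2 ⊕ κ) F :=
  fromBlocks !![0, 1; 1, 0] 0 0 B

omit [Fintype κ] in
theorem isSymm_hyperbolicSum {B : Matrix κ κ F} (hB : B.IsSymm) : (hyperbolicSum B).IsSymm :=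
  IsSymm.fromBlocks (IsSymm.ext (by simp [Fin.forall_fin_two])) (by simp) hB

theorem det_hyperbolicSum [DecidableEq κ] (B : Matrix κ κ F) :
    (hyperbolicSum B).det = -B.det := by
  rw [hyperbolicSum, det_fromBlocks_zero₂₁, det_fin_two_of]
  ring

theorem dotProduct_hyperbolicSum_mulVec (B : Matrix κ κ F) (a b : F) (y : κ → F) :
    Sum.elim ![a, b] y ⬝ᵥ hyperbolicSum B *ᵥ Sum.elim ![a, b] y =
      2 * a * b + y ⬝ᵥ B *ᵥ y := by
  rw [hyperbolicSum, fromBlocks_mulVec, sumElim_dotProduct_sumElim]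
  simp only [Sum.elim_comp_inl, Sum.elim_comp_inr, zero_mulVec, add_zero, zero_add,
    dotProduct, mulVec, Fin.sum_univ_two, of_apply, cons_val_zero, cons_val_one]
  ring

theorem card_units_le_two_mul_card_squares (F : Type*) [Field F] [Fintype F] :
    Fintype.card F - 1 ≤ 2 * Nat.card {c : F // c ≠ 0 ∧ IsSquare c} := by
  classical
  rw [Nat.card_eq_fintype_card, ← Fintype.card_units, ← card_univ, ← card_univ]
  refine card_le_mul_card_image_of_maps_to
    (f := fun u : Fˣ => (⟨u * u, mul_ne_zero u.ne_zero u.ne_zero, IsSquare.mul_self _⟩ :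
      {c : F // c ≠ 0 ∧ IsSquare c}))
    (fun _ _ => mem_univ _) 2 fun c _ => ?_
  obtain ⟨r, hr⟩ := c.2.2
  refine (card_le_card_of_injOn (t := {r, -r}) Units.val (fun u hu => ?_)
    Units.val_injective.injOn).trans card_le_two
  have hur : (u * u : F) = r * r := (Subtype.ext_iff.1 (mem_filter.1 hu).2).trans hr
  simpa using mul_self_eq_mul_self_iff.1 hur

theorem le_card_squareNormPoints_hyperbolicSum [Fintype F] (h2 : (2 : F) ≠ 0)
    (B : Matrix κ κ F) :
    (Fintype.card F - 1) * Fintype.card F ^ Fintype.card κ ≤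
      2 * Nat.card (squareNormPoints (hyperbolicSum B)) := by
  let v (p : {c : F // c ≠ 0 ∧ IsSquare c} × (κ → F)) : Fin 2 ⊕ κ → F :=
    Sum.elim ![1, (p.1 - p.2 ⬝ᵥ B *ᵥ p.2) / 2] p.2
  have hv (p) : v p ≠ 0 := fun h => one_ne_zero (congrFun h (Sum.inl 0))
  have hnorm (p) : v p ⬝ᵥ hyperbolicSum B *ᵥ v p = p.1 := by
    rw [dotProduct_hyperbolicSum_mulVec]
    field_simp
    ring
  let g (p) : squareNormPoints (hyperbolicSum B) :=
    ⟨Projectivization.mk F (v p) (hv p),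
      mk_mem_squareNormPoints (hv p) (by rw [hnorm]; exact p.1.2.1) (by rw [hnorm]; exact p.1.2.2)⟩
  have hg : Function.Injective g := fun p p' h => by
    obtain ⟨a, ha⟩ := (Projectivization.mk_eq_mk_iff' F _ _ (hv p) (hv p')).1 (Subtype.ext_iff.1 h)
    have ha1 : a = 1 := by simpa [v] using congrFun ha (Sum.inl 0)
    have hvv : v p = v p' := by rw [← ha, ha1, one_smul]
    refine Prod.ext (Subtype.ext ?_) (funext fun i => congrFun hvv (Sum.inr i))
    rw [← hnorm p, ← hnorm p', hvv]
  calc (Fintype.card F - 1) * Fintype.card F ^ Fintype.card κ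
      ≤ 2 * Nat.card {c : F // c ≠ 0 ∧ IsSquare c} * Fintype.card F ^ Fintype.card κ := by
        gcongr
        exact card_units_le_two_mul_card_squares F
    _ = 2 * Nat.card ({c : F // c ≠ 0 ∧ IsSquare c} × (κ → F)) := by
        classical
        rw [Nat.card_prod, Nat.card_eq_fintype_card (α := κ → F), Fintype.card_fun, mul_assoc]
    _ ≤ 2 * Nat.card (squareNormPoints (hyperbolicSum B)) := by
        gcongr
        exact Nat.card_le_card_of_injective g hg

end HyperbolicSum

theorem edgesBetween_univ {V : Type*} [Fintype V] (G : SimpleGraph V) :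
    edgesBetween G univ univ = 2 * G.edgeSet.ncard := by
  classical
  rw [← G.coe_edgeFinset, Set.ncard_coe_finset, ← G.sum_degrees_eq_twice_card_edges]
  simp only [edgesBetween, SimpleGraph.interedges, Rel.interedges, card_filter, sum_product,
    ← G.card_neighborFinset_eq_degree, G.neighborFinset_eq_filter]

theorem edgesBetween_map {V W : Type*} {G : SimpleGraph V} {H : SimpleGraph W} (e : G ≃g H)
    (X Y : Finset V) :
    edgesBetween H (X.map e.toEquiv.toEmbedding) (Y.map e.toEquiv.toEmbedding) =
      edgesBetween G X Y := by
  classical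
  simp only [edgesBetween, SimpleGraph.interedges, Rel.interedges, card_filter, sum_product,
    sum_map]
  exact sum_congr rfl fun x _ => sum_congr rfl fun y _ => if_congr e.map_adj_iff rfl rfl

theorem IsJumbled.of_iso {V W : Type*} {G : SimpleGraph V} {H : SimpleGraph W} {p α : ℝ}
    (hG : IsJumbled G p α) (e : G ≃g H) : IsJumbled H p α := by
  refine ⟨hG.1, hG.2.1, hG.2.2.1, fun X Y => ?_⟩
  simpa only [edgesBetween_map, card_map] using hG.2.2.2 (X.map e.symm.toEquiv.toEmbedding)
    (Y.map e.symm.toEquiv.toEmbedding)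

theorem IsJumbled.le_ncard_edgeSet {V : Type*} [Finite V] {G : SimpleGraph V} {p α C : ℝ}
    (hG : IsJumbled G p α) (hα : α ≤ C * √(Nat.card V * p)) (hC : (2 * C) ^ 2 ≤ Nat.card V * p) :
    p * (Nat.card V : ℝ) ^ 2 / 4 ≤ G.edgeSet.ncard := by
  have := Fintype.ofFinite V
  obtain ⟨hp, -, -, hdisc⟩ := hG
  have hdisc := (abs_le.1 (hdisc univ univ)).1
  rw [edgesBetween_univ, card_univ, Real.sqrt_mul_self (by positivity),
    ← Nat.card_eq_fintype_card] at hdisc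
  set n : ℝ := (Nat.card V : ℝ)
  have hα' : α ≤ n * p / 2 := by
    have hroot := Real.mul_self_sqrt (show 0 ≤ n * p by positivity)
    nlinarith [Real.le_sqrt_of_sq_le hC, Real.sqrt_nonneg (n * p)]
  have hαn : α * n ≤ n * p / 2 * n := by gcongr
  push_cast at hdisc
  linarith

theorem ncard_edgeSet_le_exRand {V W : Type*} [Finite V] {F : SimpleGraph W} {G : SimpleGraph V}
    {p α C : ℝ} (hF : F.Free G) (hG : IsJumbled G p α) (hα : α ≤ C * √(Nat.card V * p)) :
    G.edgeSet.ncard ≤ exRand (Nat.card V) C F := by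
  let e := SimpleGraph.Iso.map (Finite.equivFin V) G
  refine le_csSup (bddAbove_jumbledFreeSizes _ _ _)
    ⟨_, SimpleGraph.Free.congr_right e.symm hF, ⟨p, α, hG.of_iso e, hα⟩, ?_⟩
  exact Nat.card_congr e.mapEdgeSet

theorem exists_isSymm_not_isSquare_neg_det (F : Type*) [Field F] [Finite F]
    (hF : ringChar F ≠ 2) (κ : Type*) [Fintype κ] [DecidableEq κ] [Nonempty κ] :
    ∃ B : Matrix κ κ F, B.IsSymm ∧ ¬ IsSquare (-B.det) := by
  obtain ⟨a, ha⟩ := FiniteField.exists_nonsquare hF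
  obtain ⟨k⟩ := ‹Nonempty κ›
  refine ⟨diagonal (Function.update 1 k (-a)), isSymm_diagonal _, ?_⟩
  simpa [det_diagonal, prod_update_of_mem] using ha

theorem exists_cliqueFree_isJumbled {F : Type*} [Field F] [Fintype F] (hF : ringChar F ≠ 2)
    (κ : Type*) [Fintype κ] [Nonempty κ] :
    ∃ V : Set (ℙ F (Fin 2 ⊕ κ → F)), ∃ G : SimpleGraph V,
      G.CliqueFree (Fintype.card κ + 2) ∧
      IsJumbled G (1 / Fintype.card F) √((Fintype.card F : ℝ) ^ Fintype.card κ) ∧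
      (Fintype.card F - 1) * Fintype.card F ^ Fintype.card κ ≤ 2 * Nat.card V := by
  classical
  obtain ⟨B, hB, hdet⟩ := exists_isSymm_not_isSquare_neg_det F hF κ
  rw [← det_hyperbolicSum] at hdet
  have hA := isSymm_hyperbolicSum hB
  have hunit : IsUnit (hyperbolicSum B) :=
    (isUnit_iff_isUnit_det _).2 (Ne.isUnit fun h => hdet (h ▸ IsSquare.zero))
  have hdim : Fintype.card (Fin 2 ⊕ κ) = Fintype.card κ + 2 := by
    rw [Fintype.card_sum, Fintype.card_fin, add_comm]
  refine ⟨_, squareNormGraph hA, hdim ▸ squareNormGraph_cliqueFree hA hdet, ?_,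
    le_card_squareNormPoints_hyperbolicSum (Ring.two_ne_zero hF) B⟩
  have hJ := isJumbled_squareNormGraph hA hunit
  rwa [hdim, pow_add, mul_div_cancel_right₀ _ (by positivity)] at hJ

theorem exists_le_exRand_completeGraph {F : Type*} [Field F] [Fintype F] (hF : ringChar F ≠ 2)
    (hq : 33 ≤ Fintype.card F) {t : ℕ} (ht : 3 ≤ t) :
    ∃ n : ℕ, (Fintype.card F : ℝ) ^ (t - 1) ≤ 4 * n ∧
      (n : ℝ) ^ 2 / (4 * Fintype.card F) ≤
        exRand n 2 (SimpleGraph.completeGraph (Fin t)) := by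
  obtain ⟨m, rfl⟩ : ∃ m, t = m + 1 + 2 := ⟨t - 3, by omega⟩
  obtain ⟨V, G, hfree, hJ, hcard⟩ := exists_cliqueFree_isJumbled hF (Fin (m + 1))
  replace hfree : (SimpleGraph.completeGraph (Fin (m + 1 + 2))).Free G :=
    SimpleGraph.cliqueFree_iff_top_free.1 (by simpa only [Fintype.card_fin] using hfree)
  rw [Fintype.card_fin] at hJ hcard
  have hq' : (33 : ℝ) ≤ Fintype.card F := by exact_mod_cast hq
  set q : ℝ := (Fintype.card F : ℝ) with hqdef
  have hn : (q - 1) * q ^ (m + 1) ≤ 2 * Nat.card V := by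
    rw [hqdef, ← Nat.cast_pred Fintype.card_pos]
    simpa using (Nat.cast_le (α := ℝ)).2 hcard
  have hn' : q ^ (m + 1 + 1) ≤ 4 * Nat.card V := by
    have : q / 2 * q ^ (m + 1) ≤ (q - 1) * q ^ (m + 1) := by gcongr; linarith
    rw [pow_succ]
    linarith
  have hα : √(q ^ (m + 1)) ≤ 2 * √(Nat.card V * (1 / q)) := by
    rw [Real.sqrt_le_left (by positivity), mul_pow, Real.sq_sqrt (by positivity), mul_one_div,
      ← mul_div_assoc, le_div_iff₀ (by positivity), ← pow_succ]
    linarith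
  have hdegree : (2 * 2) ^ 2 ≤ Nat.card V * (1 / q) := by
    have : q ≤ q ^ (m + 1) := le_self_pow₀ (by linarith) (by omega)
    rw [mul_one_div, le_div_iff₀ (by positivity)]
    nlinarith
  refine ⟨Nat.card V, hn', ?_⟩
  calc (Nat.card V : ℝ) ^ 2 / (4 * q) = 1 / q * (Nat.card V : ℝ) ^ 2 / 4 := by ring
    _ ≤ (G.edgeSet.ncard : ℝ) := hJ.le_ncard_edgeSet hα hdegree
    _ ≤ _ := Nat.cast_le.2 (ncard_edgeSet_le_exRand hfree hJ hα)

theorem le_log_div_log {n N : ℕ} {c θ : ℝ} (hn : 2 ≤ n) (hc : 0 < c)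
    (h : c * (n : ℝ) ^ θ ≤ N / n) :
    ((θ + Real.log c / Real.log n : ℝ) : EReal) ≤
      ENNReal.log ((N : ℝ≥0∞) / (n : ℝ≥0∞)) / ((Real.log (n : ℝ) : ℝ) : EReal) := by
  have hn0 : (0 : ℝ) < n := by positivity
  have hlog : 0 < Real.log n := Real.log_pos (by exact_mod_cast hn)
  have hpos : 0 < c * (n : ℝ) ^ θ := by positivity
  have hcast : (N : ℝ≥0∞) / (n : ℝ≥0∞) = ENNReal.ofReal (N / n) := by
    rw [ENNReal.ofReal_div_of_pos hn0, ENNReal.ofReal_natCast, ENNReal.ofReal_natCast]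
  rw [hcast, ENNReal.log_ofReal_of_pos (hpos.trans_le h), ← EReal.coe_div, EReal.coe_le_coe_iff,
    le_div_iff₀ hlog]
  calc (θ + Real.log c / Real.log n) * Real.log n
      = Real.log (c * (n : ℝ) ^ θ) := by
        rw [Real.log_mul hc.ne' (by positivity), Real.log_rpow hn0]
        field_simp
        ring
    _ ≤ Real.log (N / n) := Real.log_le_log hpos h

theorem le_exponentAt_of_frequently {W : Type*} {F : SimpleGraph W} {c θ C : ℝ} (hc : 0 < c)
    (h : ∃ᶠ n : ℕ in atTop, c * (n : ℝ) ^ θ ≤ exRand n C F / n) :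
    (θ : EReal) ≤ exponentAt F C := by
  have hlim : Tendsto (fun n : ℕ => ((θ + Real.log c / Real.log n : ℝ) : EReal)) atTop
      (𝓝 (θ : EReal)) := by
    refine (continuous_coe_real_ereal.tendsto _).comp ?_
    have := (tendsto_const_nhds (x := Real.log c)).div_atTop
      (Real.tendsto_log_atTop.comp tendsto_natCast_atTop_atTop)
    simpa using this.const_add θ
  refine le_of_forall_lt_imp_le_of_dense fun b hb => le_limsup_of_frequently_le ?_
  refine (h.and_eventually ((hlim.eventually_const_lt hb).and (eventually_ge_atTop 2))).mono ?_
  rintro n ⟨hn, hbn, hn2⟩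
  exact hbn.le.trans (le_log_div_log hn2 hc hn)

theorem exponentAt_le_randExponent {W : Type*} (F : SimpleGraph W) (C : ℝ) :
    exponentAt F C ≤ randExponent F :=
  (exponentAt_mono F).ge_of_tendsto (tendsto_exponentAt F) C

theorem mul_rpow_one_sub_inv_le_div {k n N : ℕ} {q : ℝ} (hk : k ≠ 0) (hq : 0 < q) (hn : 0 < n)
    (hqn : q ^ k ≤ 4 * n) (hN : (n : ℝ) ^ 2 / (4 * q) ≤ N) :
    1 / 16 * (n : ℝ) ^ (1 - 1 / (k : ℝ)) ≤ N / n := by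
  have hn0 : (0 : ℝ) < n := by exact_mod_cast hn
  set r := (n : ℝ) ^ (1 / (k : ℝ)) with hr
  have hqr : q ≤ 4 * r := by
    refine le_of_pow_le_pow_left₀ hk (by positivity) ?_
    calc q ^ k ≤ 4 * n := hqn
      _ ≤ 4 ^ k * n := by gcongr; exact le_self_pow₀ (by norm_num) hk
      _ = (4 * r) ^ k := by rw [mul_pow, hr, one_div, Real.rpow_inv_natCast_pow hn0.le hk]
  calc 1 / 16 * (n : ℝ) ^ (1 - 1 / (k : ℝ)) = n / (4 * (4 * r)) := by
        rw [Real.rpow_sub hn0, Real.rpow_one]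
        ring
    _ ≤ n / (4 * q) := by gcongr
    _ = (n : ℝ) ^ 2 / (4 * q) / n := by field_simp
    _ ≤ N / n := by gcongr

theorem frequently_le_exRand_completeGraph {t : ℕ} (ht : 3 ≤ t) :
    ∃ᶠ n : ℕ in atTop, 1 / 16 * (n : ℝ) ^ (1 - 1 / ((t : ℝ) - 1)) ≤
      exRand n 2 (SimpleGraph.completeGraph (Fin t)) / n := by
  rw [← Nat.cast_pred (by omega), frequently_atTop]
  intro N
  obtain ⟨p, hp, hprime⟩ := Nat.exists_infinite_primes (4 * N + 33)
  have : Fact p.Prime := ⟨hprime⟩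
  obtain ⟨n, hpow, hex⟩ := exists_le_exRand_completeGraph (F := ZMod p)
    (by rw [ZMod.ringChar_zmod_n]; omega) (by rw [ZMod.card]; omega) ht
  rw [ZMod.card] at hpow hex
  have hpn : p ≤ 4 * n :=
    calc p ≤ p ^ (t - 1) := Nat.le_self_pow (by omega) p
      _ ≤ 4 * n := by exact_mod_cast hpow
  exact ⟨n, by omega, mul_rpow_one_sub_inv_le_div (by omega) (by exact_mod_cast hprime.pos)
    (by omega) hpow hex⟩

end PseudorandomTuran

theorem theorem1p1_general (t : ℕ) (ht : 3 ≤ t) :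
    ((1 - 1 / ((t : ℝ) - 1) : ℝ) : EReal) ≤
      PseudorandomTuran.randExponent (SimpleGraph.completeGraph (Fin t)) :=
  (PseudorandomTuran.le_exponentAt_of_frequently (by norm_num)
    (PseudorandomTuran.frequently_le_exRand_completeGraph ht)).trans
    (PseudorandomTuran.exponentAt_le_randExponent _ 2)

theorem theorem1p1 (t : ℕ) (ht : 4 ≤ t) :
    ((1 - 1 / ((t : ℝ) - 1) : ℝ) : EReal) ≤
      PseudorandomTuran.randExponent (SimpleGraph.completeGraph (Fin t)) :=
  theorem1p1_general t (by omega)
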